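/- Let $h>R>0$, $\varepsilon_*\in(0,1)$, $\delta_0,\delta_1>0$, and write $D(\xi,\rho)\subset\mathbb R^2$ for the open disk with center $\xi$ and radius $\rho$. Let $$\Omega=\{(x,y,z): x^2+y^2<R^2,\ -h<z<h\},\qquad \Omega_\pm=\{(x,y,z)\in\Omega:\ \pm z>0\},\qquad \Sigma=D((0,0),R),$$ where subsets of $\mathbb R^2$ are also regarded as subsets of the plane $z=0$. There is a constant $C_*>0$, depending only on $R,h,\delta_0,\delta_1$ and $\varepsilon_*$, with the following property. Let $(K_n)_{n\in\mathbb N}$ be open, bounded, simply connected subsets of $\mathbb R^2$ with $\mathcal C^2$ boundary, with $(0,0)\in K_n$ for all $n$, $\sup_n|K_n|<\infty$ and $\varepsilon_*|K_n|<\pi R^2$ for all $n$. Let $\alpha>0$ and $r_\varepsilon=\exp(-\varepsilon^{-\alpha})$. Suppose that for every $\varepsilon\in(0,\varepsilon_*]$ there are given an integer $N(\varepsilon)\ge 1$ and points $\xi^\varepsilon_1,\dots,\xi^\varepsilon_{N(\varepsilon)}\in\mathbb R^2$ such that, for all $n\neq m$ in $\{1,\dots,N(\varepsilon)\}$, $$\xi^\varepsilon_n+r_\varepsilon\overline{K_n}\subset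 D(\xi^\varepsilon_n,\delta_0r_\varepsilon)\subset D(\xi^\varepsilon_n,\delta_1\varepsilon)\subset\Sigma,$$ $$\partial D(\xi^\varepsilon_n,\delta_1\varepsilon)\cap\partial D(\xi^\varepsilon_m,\delta_1\varepsilon)=\emptyset,\qquad \partial D(\xi^\varepsilon_n,\delta_1\varepsilon)\cap\partial\Sigma=\emptyset.$$ Let $\Gamma_\varepsilon=\Sigma\setminus\bigcup_{n=1}^{N(\varepsilon)}\overline{\xi^\varepsilon_n+r_\varepsilon K_n}$ be the sieve and $\Omega_\varepsilon=\Omega\setminus\overline{\Gamma_\varepsilon}$. Then for every $\varepsilon\in(0,\varepsilon_*]$ and every (scalar or vector valued) $\varphi\in H^1(\Omega_\varepsilon)$ that vanishes on $\Gamma_\varepsilon$, meaning that the traces on $\Sigma$ of $\varphi|_{\Omega_+}$ and of $\varphi|_{\Omega_-}$ both vanish almost everywhere on $\Gamma_\varepsilon$, there holds $$\|\varphi\|_{L^2(\Sigma)}\le C_*\sqrt{r_\varepsilon}\,\|\nabla\varphi\|_{L^2(\Omega_\varepsilon)},$$ where on the left either of the two traces on $\Sigma$ may be taken. -/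

import Mathlib

open MeasureTheory Filter Topology Set
open scoped ENNReal ContDiff

/-- The horizontal plane `ℝ²` with its Euclidean norm and Lebesgue measure. -/
abbrev Plane : Type := EuclideanSpace ℝ (Fin 2)

/-- The space `ℝ³`, a point `(x, y, z)` being written as `((x, y), z)`. Its topology and its
Lebesgue measure (the product measure) are the usual ones. -/
abbrev Space3 : Type := Plane × ℝ

/-- The unit vectors of the three coordinate axes of `ℝ³`. -/
noncomputable def axisDir : Fin 3 → Space3 :=
  ![(EuclideanSpace.single 0 1, 0), (EuclideanSpace.single 1 1, 0), (0, 1)]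

/-- Values of gradients of `F`-valued functions: triples of partial derivatives, with the
Frobenius norm `(∑ i, ‖∂ᵢ φ‖²)^(1/2)`. -/
abbrev GradVal (F : Type) [NormedAddCommGroup F] : Type := PiLp 2 (fun _ : Fin 3 => F)

section Geometry

/-- The open disk `D(ξ, ρ)`. -/
abbrev disk (ξ : Plane) (ρ : ℝ) : Set Plane := Metric.ball ξ ρ

/-- The cross-section `Σ = D((0,0), R)`. -/
abbrev crossSection (R : ℝ) : Set Plane := disk 0 R

/-- The open cylinder `Ω` of radius `R` and length `2h`. -/
def cylinder (R h : ℝ) : Set Space3 := {p | p.1 ∈ crossSection R ∧ -h < p.2 ∧ p.2 < h}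

/-- `Ω₊`, the part of `Ω` with `0 < z < h`. -/
def upperCylinder (R h : ℝ) : Set Space3 := {p | p ∈ cylinder R h ∧ 0 < p.2 ∧ p.2 < h}

/-- `Ω₋`, the part of `Ω` with `-h < z < 0`. -/
def lowerCylinder (R h : ℝ) : Set Space3 := {p | p ∈ cylinder R h ∧ -h < p.2 ∧ p.2 < 0}

/-- `K` has a boundary of class `C²`: near each boundary point, `K` is the negativity set of a
`C²` function whose differential does not vanish at that point. -/
def HasC2Boundary (K : Set Plane) : Prop :=
  ∀ p ∈ frontier K, ∃ U : Set Plane, IsOpen U ∧ p ∈ U ∧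
    ∃ g : Plane → ℝ, ContDiff ℝ 2 g ∧ fderiv ℝ g p ≠ 0 ∧ K ∩ U = {x | x ∈ U ∧ g x < 0}

/-- The scaled and translated set `ξ + r A`. -/
def place (ξ : Plane) (r : ℝ) (A : Set Plane) : Set Plane := (fun x => ξ + r • x) '' A

/-- The size `r_ε = exp(-ε^(-α))` of the perforations. -/
noncomputable def holeScale (α ε : ℝ) : ℝ := Real.exp (-(ε ^ (-α)))

/-- The reference shapes `K_n`: open, bounded, simply connected subsets of the plane with
`C²` boundary, containing the origin, with uniformly bounded areas. -/
structure AdmissibleShapes (K : ℕ → Set Plane) : Prop where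
  isOpen : ∀ n, IsOpen (K n)
  isBounded : ∀ n, Bornology.IsBounded (K n)
  simplyConnected : ∀ n, SimplyConnectedSpace (K n)
  c2Boundary : ∀ n, HasC2Boundary (K n)
  zero_mem : ∀ n, (0 : Plane) ∈ K n
  area_bounded : ⨆ n, volume (K n) < ⊤

/-- The conditions on the `N ≥ 1` perforations `ξ_n + r K_n`, `1 ≤ n ≤ N`, at a level `ε`, where
`r` is the size of the perforations. -/
structure AdmissiblePerforation (R δ₀ δ₁ ε r : ℝ) (K : ℕ → Set Plane) (N : ℕ) (ξ : ℕ → Plane) :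
    Prop where
  one_le : 1 ≤ N
  hole_subset : ∀ n ∈ Finset.Icc 1 N, place (ξ n) r (closure (K n)) ⊆ disk (ξ n) (δ₀ * r)
  disk_subset : ∀ n ∈ Finset.Icc 1 N, disk (ξ n) (δ₀ * r) ⊆ disk (ξ n) (δ₁ * ε)
  subset_section : ∀ n ∈ Finset.Icc 1 N, disk (ξ n) (δ₁ * ε) ⊆ crossSection R
  disjoint : ∀ n ∈ Finset.Icc 1 N, ∀ m ∈ Finset.Icc 1 N, n ≠ m →
    frontier (disk (ξ n) (δ₁ * ε)) ∩ frontier (disk (ξ m) (δ₁ * ε)) = ∅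
  away_from_boundary : ∀ n ∈ Finset.Icc 1 N,
    frontier (disk (ξ n) (δ₁ * ε)) ∩ frontier (crossSection R) = ∅

/-- The sieve `Γ_ε = Σ \ ⋃ₙ closure (ξ_n + r K_n)`, as a subset of the plane `z = 0`. -/
def sieve (R r : ℝ) (K : ℕ → Set Plane) (N : ℕ) (ξ : ℕ → Plane) : Set Plane :=
  crossSection R \ ⋃ n ∈ Finset.Icc 1 N, closure (place (ξ n) r (K n))

/-- The fluid domain `Ω_ε = Ω \ closure Γ_ε`. -/
def fluidDomain (R h r : ℝ) (K : ℕ → Set Plane) (N : ℕ) (ξ : ℕ → Plane) : Set Space3 :=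
  cylinder R h \ closure ((fun x : Plane => ((x, 0) : Space3)) '' sieve R r K N ξ)

end Geometry

section Sobolev

variable {F : Type} [NormedAddCommGroup F] [InnerProductSpace ℝ F]

/-- The classical gradient of a function on `ℝ³`. -/
noncomputable def classicalGrad (u : Space3 → F) (x : Space3) : GradVal F :=
  WithLp.toLp 2 (fun i => fderiv ℝ u x (axisDir i))

/-- `G` is the weak gradient of `φ` on `U`, tested against all `ψ ∈ C_c^∞(U)`. -/
def HasWeakGrad (U : Set Space3) (φ : Space3 → F) (G : Space3 → GradVal F) : Prop :=
  ∀ i : Fin 3, ∀ ψ : Space3 → ℝ, ContDiff ℝ ∞ ψ → HasCompactSupport ψ → tsupport ψ ⊆ U →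
    ∫ x in U, (fderiv ℝ ψ x (axisDir i)) • φ x = - ∫ x in U, ψ x • G x i

/-- `φ ∈ H¹(U)`, with weak gradient `G`. -/
structure IsH1 (U : Set Space3) (φ : Space3 → F) (G : Space3 → GradVal F) : Prop where
  memLp : MemLp φ 2 (volume.restrict U)
  memLp_grad : MemLp G 2 (volume.restrict U)
  hasWeakGrad : HasWeakGrad U φ G

/-- `g ∈ L²(Σ)` is the trace on `Σ` of the function `φ ∈ H¹(U)` with weak gradient `G`, where `U`
is one of the Lipschitz domains `Ω₊`, `Ω₋`. The trace operator is the continuous extension of the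
restriction to `Σ` of functions that are smooth up to the boundary; so `g` is the `L²(Σ)`-limit of
`u_k` restricted to `Σ`, for smooth `u_k` that converge to `φ` in `H¹(U)`. -/
def IsTrace (R : ℝ) (U : Set Space3) (φ : Space3 → F) (G : Space3 → GradVal F)
    (g : Plane → F) : Prop :=
  MemLp g 2 (volume.restrict (crossSection R)) ∧
  ∃ u : ℕ → Space3 → F, (∀ k, ContDiff ℝ ∞ (u k)) ∧
    Tendsto (fun k => eLpNorm (fun x => u k x - φ x) 2 (volume.restrict U)) atTop (𝓝 0) ∧
    Tendsto (fun k => eLpNorm (fun x => classicalGrad (u k) x - G x) 2 (volume.restrict U))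
      atTop (𝓝 0) ∧
    Tendsto (fun k => eLpNorm (fun x : Plane => u k (x, 0) - g x) 2
      (volume.restrict (crossSection R))) atTop (𝓝 0)

end Sobolev

/-! The core is a trace Poincaré inequality at scale `ρ`: if a trace vanishes on a fraction `θ` of a
disk of radius `ρ`, its squared `L²` norm on the disk is at most `432 ρ / θ` times the squared
gradient norm on the one-sided cylinder of height `ρ` over the disk (`trace_poincare`). For smooth
functions, two points of the disk are joined by going up to height `s`, across, and down again, with
an average over `s`; density gives the rest.

Write `a = δ₀ r_ε`. If `2a ≤ δ₁ ε`, the disks of radius `2a` about the centers are disjoint and the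
trace vanishes on the annuli outside radius `a`, so summing the inequality at scale `2a` gives a
constant of order `a`, hence of order `r_ε` (`trace_estimate_of_small_holes`).

If `2a > δ₁ ε`, then `ε` is bounded below independently of `α` (`exists_lower_bound_scale`):
comparing levels `ε` and `√ε`, where the exponent in the hole size gets squared, rules out small
`ε`. So `r_ε` is bounded below, and any fixed constant will do. The disks of radius `δ₁ ε` are
disjoint with radii in a compact subinterval of `(0, R)`, so they leave a fixed fraction of `Σ`
uncovered (`exists_uncovered_fraction`), and the inequality is applied at scale `R`. -/

/-! ### Oscillation estimates along segments and on convex sets -/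

/-- Cauchy–Schwarz against the constant function `1`. -/
theorem sq_lintegral_le {X : Type*} [MeasurableSpace X] (μ : Measure X) {f : X → ℝ≥0∞}
    (hf : AEMeasurable f μ) : (∫⁻ x, f x ∂μ) ^ 2 ≤ μ univ * ∫⁻ x, f x ^ 2 ∂μ := by
  have h := ENNReal.lintegral_mul_le_Lp_mul_Lq μ Real.HolderConjugate.two_two
    (aemeasurable_const (b := (1 : ℝ≥0∞))) hf
  have h2 := pow_le_pow_left₀ (zero_le) h 2
  rw [mul_pow, ← ENNReal.rpow_natCast, ← ENNReal.rpow_natCast, ← ENNReal.rpow_natCast,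
    ← ENNReal.rpow_mul, ← ENNReal.rpow_mul] at h2
  simpa using h2

/-- Fundamental theorem of calculus followed by Cauchy–Schwarz on the interval between `0` and `s`;
`uIoc` serves both signs of `s`. -/
theorem enorm_sub_sq_le_lintegral_deriv {F : Type*} [NormedAddCommGroup F] [NormedSpace ℝ F]
    [CompleteSpace F] {f f' : ℝ → F} (hf : ∀ t, HasDerivAt f (f' t) t) (hc : Continuous f')
    (s : ℝ) : ‖f s - f 0‖ₑ ^ 2 ≤ ENNReal.ofReal |s| * ∫⁻ t in uIoc 0 s, ‖f' t‖ₑ ^ 2 := by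
  have h1 : f s - f 0 = ∫ t in (0 : ℝ)..s, f' t :=
    (intervalIntegral.integral_eq_sub_of_hasDerivAt (fun t _ => hf t)
      (hc.intervalIntegrable _ _)).symm
  have h2 : ‖f s - f 0‖ₑ ≤ ∫⁻ t in uIoc 0 s, ‖f' t‖ₑ := by
    have : ‖f s - f 0‖ₑ = ‖∫ t in uIoc 0 s, f' t‖ₑ := by
      rw [h1, ← ofReal_norm, ← ofReal_norm,
        intervalIntegral.norm_intervalIntegral_eq]
    rw [this]
    exact enorm_integral_le_lintegral_enorm _
  calc ‖f s - f 0‖ₑ ^ 2 ≤ (∫⁻ t in uIoc 0 s, ‖f' t‖ₑ) ^ 2 := by gcongr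
    _ ≤ _ := sq_lintegral_le _ hc.enorm.measurable.aemeasurable
    _ = _ := by simp [Real.volume_uIoc]

/-- Poincaré inequality on a convex set, in double-integral form. -/
theorem lintegral_lintegral_enorm_sub_sq_le {E F : Type*} [NormedAddCommGroup E]
    [InnerProductSpace ℝ E] [FiniteDimensional ℝ E] [MeasurableSpace E] [BorelSpace E]
    [NormedAddCommGroup F] {D : Set E} (hD : MeasurableSet D) (hconv : Convex ℝ D) {d : ℝ}
    (hd : ∀ x ∈ D, ∀ y ∈ D, dist y x < d) {w : E → F} (hw : Continuous w) {H : E → ℝ≥0∞}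
    (hH : Measurable H)
    (hwH : ∀ x v, ‖w (x + v) - w x‖ₑ ^ 2 ≤
      ‖v‖ₑ ^ 2 * ∫⁻ t in Ioc (0 : ℝ) 1, H (x + t • v)) :
    ∫⁻ x in D, ∫⁻ y in D, ‖w y - w x‖ₑ ^ 2 ≤
      volume (Metric.ball (0 : E) d) * ENNReal.ofReal d ^ 2 * ∫⁻ x in D, H x := by
  have hHm : Measurable (D.indicator H) := hH.indicator hD
  have hmw : Measurable fun p : E × E => ‖w p.2 - w p.1‖ₑ ^ 2 :=
    ((hw.comp continuous_snd).sub (hw.comp continuous_fst)).enorm.measurable.pow_const 2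
  have hm : Measurable fun p : E × E =>
      (D ×ˢ D).indicator (fun p : E × E => ‖w p.2 - w p.1‖ₑ ^ 2) p :=
    hmw.indicator (hD.prod hD)
  -- The pairs are sorted by their displacement `v = y - x`. Only `‖v‖ < d` contributes, which
  -- produces the volume of the ball of radius `d`.
  have hsub : ∀ v : E, ∫⁻ x, (D ×ˢ D).indicator
      (fun p : E × E => ‖w p.2 - w p.1‖ₑ ^ 2) (x, x + v) ≤
      (Metric.ball (0 : E) d).indicator
        (fun _ => ENNReal.ofReal d ^ 2 * ∫⁻ x in D, H x) v := by
    intro v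
    by_cases hv : v ∈ Metric.ball (0 : E) d
    · rw [indicator_of_mem hv]
      have hvn : ‖v‖ₑ ≤ ENNReal.ofReal d := by
        rw [← ofReal_norm]
        exact ENNReal.ofReal_le_ofReal (mem_ball_zero_iff.1 hv).le
      have hpt : ∀ x, (D ×ˢ D).indicator (fun p : E × E => ‖w p.2 - w p.1‖ₑ ^ 2) (x, x + v) ≤
          -- Convexity keeps the segment inside `D`, so `H` may be cut off to `D`. After the swap of
          -- integrals, translation invariance makes the inner integral independent of `t` and `v`.
          ‖v‖ₑ ^ 2 * ∫⁻ t in Ioc (0 : ℝ) 1, D.indicator H (x + t • v) := by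
        intro x
        by_cases hx : (x, x + v) ∈ D ×ˢ D
        · rw [indicator_of_mem hx]
          refine (hwH x v).trans (mul_le_mul_right (le_of_eq ?_) _)
          refine setLIntegral_congr_fun measurableSet_Ioc fun t ht => ?_
          have : x + t • v ∈ D := by
            have := hconv.add_smul_sub_mem hx.1 hx.2 ⟨ht.1.le, ht.2⟩
            simpa using this
          exact (indicator_of_mem this H).symm
        · rw [indicator_of_notMem hx]; exact zero_le
      calc _ ≤ ∫⁻ x, ‖v‖ₑ ^ 2 * ∫⁻ t in Ioc (0 : ℝ) 1, D.indicator H (x + t • v) :=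
            lintegral_mono hpt
        _ = ‖v‖ₑ ^ 2 * ∫⁻ x, ∫⁻ t in Ioc (0 : ℝ) 1, D.indicator H (x + t • v) :=
            lintegral_const_mul' _ _ (by simp)
        _ = ‖v‖ₑ ^ 2 * ∫⁻ t in Ioc (0 : ℝ) 1, ∫⁻ x, D.indicator H (x + t • v) := by
            rw [lintegral_lintegral_swap]
            refine Measurable.aemeasurable ?_
            exact hHm.comp (by fun_prop)
        _ = ‖v‖ₑ ^ 2 * ∫⁻ x in D, H x := by
            simp_rw [lintegral_add_right_eq_self (D.indicator H), lintegral_indicator hD]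
            simp
        _ ≤ _ := by gcongr
    · rw [indicator_of_notMem hv]
      refine le_of_eq ((lintegral_congr fun x => indicator_of_notMem (fun hx => hv ?_) _).trans
        lintegral_zero)
      simpa using hd x hx.1 (x + v) hx.2
  calc ∫⁻ x in D, ∫⁻ y in D, ‖w y - w x‖ₑ ^ 2
      = ∫⁻ x, ∫⁻ y, (D ×ˢ D).indicator (fun p : E × E => ‖w p.2 - w p.1‖ₑ ^ 2) (x, y) := by
        rw [← lintegral_indicator hD]
        refine lintegral_congr fun x => ?_
        by_cases hx : x ∈ D
        · rw [indicator_of_mem hx, ← lintegral_indicator hD]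
          refine lintegral_congr fun y => ?_
          by_cases hy : y ∈ D <;> simp [hx, hy]
        · rw [indicator_of_notMem hx]
          simp [hx]
    _ = ∫⁻ x, ∫⁻ v, (D ×ˢ D).indicator
          (fun p : E × E => ‖w p.2 - w p.1‖ₑ ^ 2) (x, x + v) := by
        refine lintegral_congr fun x => ?_
        exact (lintegral_add_left_eq_self (fun y => (D ×ˢ D).indicator
          (fun p : E × E => ‖w p.2 - w p.1‖ₑ ^ 2) (x, y)) x).symm
    _ = ∫⁻ v, ∫⁻ x, (D ×ˢ D).indicator
          (fun p : E × E => ‖w p.2 - w p.1‖ₑ ^ 2) (x, x + v) := by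
        refine lintegral_lintegral_swap (Measurable.aemeasurable ?_)
        exact hm.comp (measurable_fst.prodMk (measurable_fst.add measurable_snd))
    _ ≤ ∫⁻ v, (Metric.ball (0 : E) d).indicator
          (fun _ => ENNReal.ofReal d ^ 2 * ∫⁻ x in D, H x) v := lintegral_mono hsub
    _ = _ := by
        rw [lintegral_indicator Metric.isOpen_ball.measurableSet, setLIntegral_const]
        ring

theorem enorm_sub_sq_le_three {F : Type*} [NormedAddCommGroup F] (a b c d : F) :
    ‖a - d‖ₑ ^ 2 ≤ 3 * (‖a - b‖ₑ ^ 2 + ‖b - c‖ₑ ^ 2 + ‖c - d‖ₑ ^ 2) := by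
  have h : ‖a - d‖ ≤ ‖a - b‖ + ‖b - c‖ + ‖c - d‖ := by
    calc ‖a - d‖ = ‖(a - b) + (b - c) + (c - d)‖ := by congr 1; abel
      _ ≤ _ := norm_add₃_le
  have h2 : ‖a - d‖ ^ 2 ≤ 3 * (‖a - b‖ ^ 2 + ‖b - c‖ ^ 2 + ‖c - d‖ ^ 2) := by
    nlinarith [norm_nonneg (a - d), sq_nonneg (‖a - b‖ - ‖b - c‖),
      sq_nonneg (‖a - b‖ - ‖c - d‖), sq_nonneg (‖b - c‖ - ‖c - d‖)]
  simp only [← ofReal_norm]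
  have h3 := ENNReal.ofReal_le_ofReal h2
  rw [ENNReal.ofReal_mul (by norm_num), ENNReal.ofReal_add (by positivity) (by positivity),
    ENNReal.ofReal_add (by positivity) (by positivity)] at h3
  simpa [ENNReal.ofReal_pow] using h3

theorem enorm_sq_le_two {F : Type*} [NormedAddCommGroup F] (a b : F) :
    ‖a‖ₑ ^ 2 ≤ 2 * (‖b‖ₑ ^ 2 + ‖a - b‖ₑ ^ 2) := by
  have h : ‖a‖ ≤ ‖b‖ + ‖a - b‖ := by
    calc ‖a‖ = ‖b + (a - b)‖ := by congr 1; abel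
      _ ≤ _ := norm_add_le _ _
  have h2 : ‖a‖ ^ 2 ≤ 2 * (‖b‖ ^ 2 + ‖a - b‖ ^ 2) := by
    nlinarith [norm_nonneg a, sq_nonneg (‖b‖ - ‖a - b‖)]
  simp only [← ofReal_norm]
  have h3 := ENNReal.ofReal_le_ofReal h2
  rw [ENNReal.ofReal_mul (by norm_num), ENNReal.ofReal_add (by positivity) (by positivity)] at h3
  simpa [ENNReal.ofReal_pow] using h3

/-! ### Smooth functions: vertical and horizontal increments -/

section Gradient

variable {F : Type} [NormedAddCommGroup F] [InnerProductSpace ℝ F]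

theorem continuous_classicalGrad {u : Space3 → F} (hu : ContDiff ℝ ∞ u) :
    Continuous (classicalGrad u) := by
  have h := hu.continuous_fderiv (by simp)
  refine (PiLp.continuous_toLp 2 _).comp (continuous_pi fun i => ?_)
  exact h.clm_apply continuous_const

theorem norm_fderiv_vertical_le (u : Space3 → F) (p : Space3) :
    ‖fderiv ℝ u p (0, 1)‖ ≤ ‖classicalGrad u p‖ :=
  PiLp.norm_apply_le (classicalGrad u p) 2

theorem norm_fderiv_horizontal_le (u : Space3 → F) (p : Space3) (v : Plane) :
    ‖fderiv ℝ u p (v, 0)‖ ≤ ‖v‖ * ‖classicalGrad u p‖ := by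
  have hv : ((v, 0) : Space3) = v 0 • axisDir 0 + v 1 • axisDir 1 := by
    refine Prod.ext ?_ (by simp [axisDir])
    ext i
    fin_cases i <;> simp [axisDir]
  set a := fderiv ℝ u p (axisDir 0)
  set b := fderiv ℝ u p (axisDir 1)
  have hg : ‖a‖ ^ 2 + ‖b‖ ^ 2 ≤ ‖classicalGrad u p‖ ^ 2 := by
    rw [PiLp.norm_sq_eq_of_L2, Fin.sum_univ_three]
    exact le_add_of_nonneg_right (sq_nonneg _)
  have hvn : ‖v‖ ^ 2 = |v 0| ^ 2 + |v 1| ^ 2 := by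
    rw [EuclideanSpace.norm_sq_eq, Fin.sum_univ_two]; simp
  rw [hv, map_add, map_smul, map_smul]
  refine (norm_add_le _ _).trans ?_
  rw [norm_smul, norm_smul, Real.norm_eq_abs, Real.norm_eq_abs]
  refine abs_le_of_sq_le_sq' ?_ (by positivity) |>.2
  calc (|v 0| * ‖a‖ + |v 1| * ‖b‖) ^ 2
      ≤ (|v 0| ^ 2 + |v 1| ^ 2) * (‖a‖ ^ 2 + ‖b‖ ^ 2) := by
        nlinarith [sq_nonneg (|v 0| * ‖b‖ - |v 1| * ‖a‖)]
    _ ≤ _ := by rw [mul_pow, hvn]; gcongr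

theorem hasDerivAt_vertical {u : Space3 → F} (hu : ContDiff ℝ ∞ u) (x : Plane) (t : ℝ) :
    HasDerivAt (fun t => u (x, t)) (fderiv ℝ u (x, t) (0, 1)) t := by
  have h1 : HasFDerivAt u (fderiv ℝ u (x, t)) (x, t) :=
    (hu.differentiable (by simp) _).hasFDerivAt
  exact h1.comp_hasDerivAt t ((hasDerivAt_const t x).prodMk (hasDerivAt_id t))

theorem hasDerivAt_horizontal {u : Space3 → F} (hu : ContDiff ℝ ∞ u) (x v : Plane) (s t : ℝ) :
    HasDerivAt (fun t : ℝ => u (x + t • v, s)) (fderiv ℝ u (x + t • v, s) (v, 0)) t := by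
  have h1 : HasFDerivAt u (fderiv ℝ u (x + t • v, s)) (x + t • v, s) :=
    (hu.differentiable (by simp) _).hasFDerivAt
  refine h1.comp_hasDerivAt t (HasDerivAt.prodMk ?_ (hasDerivAt_const t s))
  simpa using ((hasDerivAt_id t).smul_const v).const_add x

variable [CompleteSpace F]

theorem enorm_vertical_sub_sq_le {u : Space3 → F} (hu : ContDiff ℝ ∞ u) (x : Plane) (s : ℝ) :
    ‖u (x, s) - u (x, 0)‖ₑ ^ 2 ≤
      ENNReal.ofReal |s| * ∫⁻ t in uIoc 0 s, ‖classicalGrad u (x, t)‖ₑ ^ 2 := by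
  have hc : Continuous fun t : ℝ => fderiv ℝ u (x, t) (0, 1) :=
    ((hu.continuous_fderiv (by simp)).comp (by fun_prop)).clm_apply continuous_const
  refine (enorm_sub_sq_le_lintegral_deriv (fun t => hasDerivAt_vertical hu x t) hc s).trans ?_
  gcongr with t
  exact enorm_le_iff_norm_le.2 (norm_fderiv_vertical_le u _)

theorem enorm_horizontal_sub_sq_le {u : Space3 → F} (hu : ContDiff ℝ ∞ u) (x v : Plane) (s : ℝ) :
    ‖u (x + v, s) - u (x, s)‖ₑ ^ 2 ≤
      ‖v‖ₑ ^ 2 * ∫⁻ t in Ioc (0 : ℝ) 1, ‖classicalGrad u (x + t • v, s)‖ₑ ^ 2 := by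
  have hc : Continuous fun t : ℝ => fderiv ℝ u (x + t • v, s) (v, 0) :=
    ((hu.continuous_fderiv (by simp)).comp (by fun_prop)).clm_apply continuous_const
  have h := enorm_sub_sq_le_lintegral_deriv (fun t => hasDerivAt_horizontal hu x v s t) hc 1
  simp only [one_smul, zero_smul, add_zero, abs_one, ENNReal.ofReal_one, one_mul,
    uIoc_of_le zero_le_one] at h
  refine h.trans ?_
  rw [← lintegral_const_mul' _ _ (by simp)]
  gcongr with t
  rw [← mul_pow, ← ofReal_norm, ← ofReal_norm, ← ofReal_norm,
    ← ENNReal.ofReal_mul (norm_nonneg _)]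
  gcongr
  exact norm_fderiv_horizontal_le u _ v

/-- The double-integral oscillation of the restriction to the plane `z = 0` is controlled by the
gradient over a cylinder of height comparable to its radius. -/
theorem lintegral_oscillation_le {u : Space3 → F} (hu : ContDiff ℝ ∞ u) {ρ : ℝ} {S : Set ℝ}
    (hS : volume S = ENNReal.ofReal ρ)
    (hSs : ∀ s ∈ S, |s| ≤ ρ ∧ volume.restrict (uIoc 0 s) ≤ volume.restrict S)
    (hSm : MeasurableSet S) (ξ : Plane) :
    ENNReal.ofReal ρ * ∫⁻ x in disk ξ ρ, ∫⁻ y in disk ξ ρ, ‖u (y, 0) - u (x, 0)‖ₑ ^ 2 ≤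
      3 * (2 * ENNReal.ofReal ρ ^ 2 * volume (disk ξ ρ) +
        volume (disk 0 (2 * ρ)) * ENNReal.ofReal (2 * ρ) ^ 2) *
        ∫⁻ x in disk ξ ρ, ∫⁻ t in S, ‖classicalGrad u (x, t)‖ₑ ^ 2 := by
  set r := ENNReal.ofReal ρ
  set D := disk ξ ρ
  have huc := hu.continuous
  have hgc := (continuous_classicalGrad hu)
  set Z : Plane → ℝ≥0∞ := fun x => ∫⁻ t in S, ‖classicalGrad u (x, t)‖ₑ ^ 2 with hZ
  have hem : Measurable fun p : Plane × ℝ => ‖classicalGrad u p‖ₑ ^ 2 :=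
    hgc.enorm.measurable.pow_const 2
  have hZm : Measurable Z := hem.lintegral_prod_right'
  have hvert : ∀ x, ∀ s ∈ S, ‖u (x, s) - u (x, 0)‖ₑ ^ 2 ≤ r * Z x := by
    intro x s hs
    refine (enorm_vertical_sub_sq_le hu x s).trans ?_
    refine mul_le_mul' (ENNReal.ofReal_le_ofReal (hSs s hs).1) ?_
    exact lintegral_mono' (hSs s hs).2 le_rfl
  set W : Plane → Plane → ℝ≥0∞ := fun x y => ∫⁻ s in S, ‖u (y, s) - u (x, s)‖ₑ ^ 2 with hW
  -- The path `(y, 0)`, `(y, s)`, `(x, s)`, `(x, 0)` is integrated over `s ∈ S`; the factor `r` on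
  -- the left is the length of `S`. Averaging over `s` turns the horizontal increments, which live
  -- on slices, into an integral over the solid cylinder.
  have hpt : ∀ x y, r * ‖u (y, 0) - u (x, 0)‖ₑ ^ 2 ≤
      3 * (r ^ 2 * Z y + r ^ 2 * Z x + W x y) := by
    intro x y
    calc r * ‖u (y, 0) - u (x, 0)‖ₑ ^ 2 = ∫⁻ s in S, ‖u (y, 0) - u (x, 0)‖ₑ ^ 2 := by
          rw [setLIntegral_const, hS, mul_comm]
      _ ≤ ∫⁻ s in S, 3 * (r * Z y + r * Z x + ‖u (y, s) - u (x, s)‖ₑ ^ 2) := by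
          refine setLIntegral_mono' hSm fun s hs => ?_
          refine (enorm_sub_sq_le_three _ (u (y, s)) (u (x, s)) _).trans ?_
          have h1 := hvert y s hs
          have h2 := hvert x s hs
          rw [← enorm_neg, neg_sub] at h1
          calc _ ≤ 3 * (r * Z y + ‖u (y, s) - u (x, s)‖ₑ ^ 2 + r * Z x) := by gcongr
            _ = _ := by ring
      _ = _ := by
          rw [lintegral_const_mul' _ _ (by simp), lintegral_add_left measurable_const,
            setLIntegral_const, hS]
          ring
  have hWint : ∫⁻ x in D, ∫⁻ y in D, W x y ≤
      volume (disk 0 (2 * ρ)) * ENNReal.ofReal (2 * ρ) ^ 2 * ∫⁻ x in D, Z x := by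
    calc ∫⁻ x in D, ∫⁻ y in D, W x y
        = ∫⁻ x in D, ∫⁻ s in S, ∫⁻ y in D, ‖u (y, s) - u (x, s)‖ₑ ^ 2 := by
          refine lintegral_congr fun x => ?_
          refine lintegral_lintegral_swap (Measurable.aemeasurable ?_)
          exact Measurable.pow_const (Continuous.measurable (by fun_prop)) 2
      _ = ∫⁻ s in S, ∫⁻ x in D, ∫⁻ y in D, ‖u (y, s) - u (x, s)‖ₑ ^ 2 := by
          refine lintegral_lintegral_swap (Measurable.aemeasurable ?_)
          refine Measurable.lintegral_prod_right'
            (f := fun q : (Plane × ℝ) × Plane => ‖u (q.2, q.1.2) - u (q.1.1, q.1.2)‖ₑ ^ 2) ?_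
          exact Measurable.pow_const (Continuous.measurable (by fun_prop)) 2
      _ ≤ ∫⁻ s in S, volume (disk 0 (2 * ρ)) * ENNReal.ofReal (2 * ρ) ^ 2 *
            ∫⁻ x in D, ‖classicalGrad u (x, s)‖ₑ ^ 2 := by
          refine lintegral_mono fun s => ?_
          refine lintegral_lintegral_enorm_sub_sq_le Metric.isOpen_ball.measurableSet
            (convex_ball _ _) ?_ (w := fun x => u (x, s)) (by fun_prop)
            (H := fun x => ‖classicalGrad u (x, s)‖ₑ ^ 2)
            (Measurable.pow_const (Continuous.measurable (by fun_prop)) 2)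
            fun x v => enorm_horizontal_sub_sq_le hu x v s
          intro x hx y hy
          have h1 : dist x ξ < ρ := hx
          have h2 : dist y ξ < ρ := hy
          linarith [dist_triangle_right y x ξ]
      _ = _ := by
          rw [lintegral_const_mul' _ _
            (ENNReal.mul_ne_top measure_ball_lt_top.ne (ENNReal.pow_ne_top ENNReal.ofReal_ne_top))]
          congr 1
          refine lintegral_lintegral_swap (Measurable.aemeasurable ?_)
          exact hem.comp measurable_swap
  calc r * ∫⁻ x in D, ∫⁻ y in D, ‖u (y, 0) - u (x, 0)‖ₑ ^ 2
      = ∫⁻ x in D, ∫⁻ y in D, r * ‖u (y, 0) - u (x, 0)‖ₑ ^ 2 := by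
        have hr : r ≠ ⊤ := ENNReal.ofReal_ne_top
        simp_rw [lintegral_const_mul' r _ hr]
    _ ≤ ∫⁻ x in D, ∫⁻ y in D, 3 * (r ^ 2 * Z y + r ^ 2 * Z x + W x y) :=
        lintegral_mono fun x => lintegral_mono fun y => hpt x y
    _ = ∫⁻ x in D, 3 * (r ^ 2 * (∫⁻ y in D, Z y) + r ^ 2 * volume D * Z x +
          ∫⁻ y in D, W x y) := by
        refine lintegral_congr fun x => ?_
        rw [lintegral_const_mul' _ _ (by simp),
          lintegral_add_left (f := fun y => r ^ 2 * Z y + r ^ 2 * Z x) (by fun_prop),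
          lintegral_add_right _ measurable_const, lintegral_const_mul _ hZm, setLIntegral_const]
        ring
    _ = 3 * (2 * r ^ 2 * volume D * (∫⁻ x in D, Z x) + ∫⁻ x in D, ∫⁻ y in D, W x y) := by
        rw [lintegral_const_mul' _ _ (by simp),
          lintegral_add_left
            (f := fun x => r ^ 2 * (∫⁻ y in D, Z y) + r ^ 2 * volume D * Z x) (by fun_prop),
          lintegral_add_left measurable_const, lintegral_const_mul _ hZm, setLIntegral_const]
        ring
    _ ≤ _ := by
        rw [mul_assoc 3, add_mul]
        gcongr

end Gradient

/-- Compare `v x` with `v y` for `y ∈ A` and integrate over `D × A`: smallness on `A` and small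
oscillation on `D` force smallness on `D`. -/
theorem volume_mul_lintegral_le {X : Type*} [MeasurableSpace X] (μ : Measure X) {F : Type*}
    [NormedAddCommGroup F] {v : X → F} (D A : Set X) (hAD : A ⊆ D)
    (hv : Measurable fun x => ‖v x‖ₑ) (hA : μ A ≠ ⊤) :
    μ A * ∫⁻ x in D, ‖v x‖ₑ ^ 2 ∂μ ≤ 2 * μ D * ∫⁻ x in A, ‖v x‖ₑ ^ 2 ∂μ +
      2 * ∫⁻ x in D, ∫⁻ y in D, ‖v y - v x‖ₑ ^ 2 ∂μ ∂μ := by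
  calc μ A * ∫⁻ x in D, ‖v x‖ₑ ^ 2 ∂μ = ∫⁻ x in D, ∫⁻ y in A, ‖v x‖ₑ ^ 2 ∂μ ∂μ := by
        simp_rw [setLIntegral_const]
        rw [lintegral_mul_const' _ _ hA, mul_comm]
    _ ≤ ∫⁻ x in D, ∫⁻ y in A, (2 * ‖v y‖ₑ ^ 2 + 2 * ‖v y - v x‖ₑ ^ 2) ∂μ ∂μ := by
        gcongr with x y
        rw [← mul_add, ← enorm_neg (v y - v x), neg_sub]
        exact enorm_sq_le_two _ _
    _ = ∫⁻ x in D, (2 * ∫⁻ y in A, ‖v y‖ₑ ^ 2 ∂μ + 2 * ∫⁻ y in A, ‖v y - v x‖ₑ ^ 2 ∂μ) ∂μ := by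
        refine lintegral_congr fun x => ?_
        rw [lintegral_add_left ((hv.pow_const 2).const_mul 2),
          lintegral_const_mul' _ _ (by simp), lintegral_const_mul' _ _ (by simp)]
    _ = 2 * μ D * ∫⁻ x in A, ‖v x‖ₑ ^ 2 ∂μ +
        2 * ∫⁻ x in D, ∫⁻ y in A, ‖v y - v x‖ₑ ^ 2 ∂μ ∂μ := by
        rw [lintegral_add_left measurable_const, setLIntegral_const,
          lintegral_const_mul' _ _ (by simp)]
        ring
    _ ≤ _ := by
        gcongr

theorem eLpNorm_two_sq {X F : Type*} [MeasurableSpace X] (μ : Measure X)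
    [NormedAddCommGroup F] (f : X → F) : eLpNorm f 2 μ ^ 2 = ∫⁻ x, ‖f x‖ₑ ^ 2 ∂μ := by
  have h := eLpNorm_nnreal_pow_eq_lintegral (f := f) (μ := μ) (p := 2) (by norm_num)
  rw [← ENNReal.rpow_natCast]
  simpa using h

theorem tendsto_lintegral_sq_zero {X F : Type*} [MeasurableSpace X] {μ : Measure X}
    [NormedAddCommGroup F] {f : ℕ → X → F}
    (h : Tendsto (fun k => eLpNorm (f k) 2 μ) atTop (𝓝 0)) :
    Tendsto (fun k => ∫⁻ x, ‖f k x‖ₑ ^ 2 ∂μ) atTop (𝓝 0) := by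
  simp_rw [← eLpNorm_two_sq]
  have h2 := (ENNReal.continuous_pow 2).continuousAt.tendsto.comp h
  rw [zero_pow two_ne_zero] at h2
  exact h2

/-! ### Trace Poincaré inequality on a disk -/

section Poincare

variable {F : Type} [NormedAddCommGroup F] [InnerProductSpace ℝ F] [CompleteSpace F]

/-- The integral over `A` is kept on the right because smooth approximants of a trace that vanishes
on `A` need not vanish there; it disappears only in the limit. -/
theorem smooth_trace_poincare {u : Space3 → F} (hu : ContDiff ℝ ∞ u) {ρ : ℝ} (hρ : 0 < ρ)
    {S : Set ℝ} (hS : volume S = ENNReal.ofReal ρ)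
    (hSs : ∀ s ∈ S, |s| ≤ ρ ∧ volume.restrict (uIoc 0 s) ≤ volume.restrict S)
    (hSm : MeasurableSet S) (ξ : Plane) {A : Set Plane} (hA : A ⊆ disk ξ ρ) {θ : ℝ≥0∞}
    (hθ : θ * volume (disk ξ ρ) ≤ volume A) :
    θ * ∫⁻ x in disk ξ ρ, ‖u (x, 0)‖ₑ ^ 2 ≤ 2 * (∫⁻ x in A, ‖u (x, 0)‖ₑ ^ 2) +
      108 * ENNReal.ofReal ρ * ∫⁻ p in disk ξ ρ ×ˢ S, ‖classicalGrad u p‖ₑ ^ 2 := by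
  have hD : volume (disk ξ ρ) ≠ ⊤ := measure_ball_lt_top.ne
  have hD0 : volume (disk ξ ρ) ≠ 0 := (Metric.measure_ball_pos _ _ hρ).ne'
  have hA' : volume A ≠ ⊤ := ((measure_mono hA).trans_lt hD.lt_top).ne
  have hE : ∫⁻ p in disk ξ ρ ×ˢ S, ‖classicalGrad u p‖ₑ ^ 2 =
      ∫⁻ x in disk ξ ρ, ∫⁻ t in S, ‖classicalGrad u (x, t)‖ₑ ^ 2 := by
    rw [Measure.volume_eq_prod, ← Measure.prod_restrict, lintegral_prod]
    exact ((continuous_classicalGrad hu).enorm.measurable.pow_const 2).aemeasurable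
  rw [hE]
  set E := ∫⁻ x in disk ξ ρ, ∫⁻ t in S, ‖classicalGrad u (x, t)‖ₑ ^ 2
  have hosc := lintegral_oscillation_le hu hS hSs hSm ξ
  have hsm := volume_mul_lintegral_le volume (v := fun x => u (x, 0)) (disk ξ ρ) A hA
    (Continuous.measurable (by have := hu.continuous; fun_prop)) hA'
  have h2 : ENNReal.ofReal (2 * ρ) = 2 * ENNReal.ofReal ρ := by
    rw [ENNReal.ofReal_mul (by norm_num)]; simp
  have hV : volume (disk 0 (2 * ρ)) = 4 * volume (disk ξ ρ) := by
    rw [EuclideanSpace.volume_ball_fin_two, EuclideanSpace.volume_ball_fin_two, h2]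
    ring
  rw [hV, h2] at hosc
  set r := ENNReal.ofReal ρ
  have hr : r ≠ ⊤ := ENNReal.ofReal_ne_top
  have hr0 : r ≠ 0 := by simpa [r] using hρ
  set V := volume (disk ξ ρ)
  -- Multiplying by the finite nonzero factor `r * V` lets both estimates be used without division.
  -- The constant is `108 = 2 · 3 · (2 + 16)`, where `16` comes from the doubled radius, squared and
  -- in the area.
  refine (ENNReal.mul_le_mul_iff_right (a := r * V) (mul_ne_zero hr0 hD0)
    (ENNReal.mul_ne_top hr hD)).1 ?_
  calc r * V * (θ * ∫⁻ x in disk ξ ρ, ‖u (x, 0)‖ₑ ^ 2)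
      = r * (θ * V * ∫⁻ x in disk ξ ρ, ‖u (x, 0)‖ₑ ^ 2) := by ring
    _ ≤ r * (volume A * ∫⁻ x in disk ξ ρ, ‖u (x, 0)‖ₑ ^ 2) := by gcongr
    _ ≤ r * (2 * V * (∫⁻ x in A, ‖u (x, 0)‖ₑ ^ 2)) + 2 * (r *
          ∫⁻ x in disk ξ ρ, ∫⁻ y in disk ξ ρ, ‖u (y, 0) - u (x, 0)‖ₑ ^ 2) := by
        refine (mul_le_mul_right hsm r).trans (le_of_eq ?_)
        ring
    _ ≤ r * (2 * V * (∫⁻ x in A, ‖u (x, 0)‖ₑ ^ 2)) +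
          2 * (3 * (2 * r ^ 2 * V + 4 * V * (2 * r) ^ 2) * E) := by gcongr
    _ = _ := by ring

/-- A trace that vanishes on a fixed fraction of a disk is controlled, in `L²` of the disk, by the
gradient on a half cylinder over the disk. -/
theorem trace_poincare {R ρ : ℝ} (hρ : 0 < ρ) {S : Set ℝ} (hS : volume S = ENNReal.ofReal ρ)
    (hSs : ∀ s ∈ S, |s| ≤ ρ ∧ volume.restrict (uIoc 0 s) ≤ volume.restrict S)
    (hSm : MeasurableSet S) {ξ : Plane} (hξ : disk ξ ρ ⊆ crossSection R) {U : Set Space3}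
    (hU : disk ξ ρ ×ˢ S ⊆ U) {φ : Space3 → F} {G : Space3 → GradVal F} {g : Plane → F}
    (hGU : AEStronglyMeasurable G (volume.restrict U)) (htr : IsTrace R U φ G g) {A : Set Plane} (hA : A ⊆ disk ξ ρ)
    (hgA : ∀ᵐ x ∂(volume.restrict A), g x = 0) {θ : ℝ≥0∞} (hθt : θ ≠ ⊤)
    (hθ : θ * volume (disk ξ ρ) ≤ volume A) :
    θ * ∫⁻ x in disk ξ ρ, ‖g x‖ₑ ^ 2 ≤
      432 * ENNReal.ofReal ρ * ∫⁻ p in disk ξ ρ ×ˢ S, ‖G p‖ₑ ^ 2 := by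
  obtain ⟨hg, u, hu, -, hgrad, htrace⟩ := htr
  set P := disk ξ ρ ×ˢ S
  set D := disk ξ ρ
  have hc1 : Tendsto (fun k => ∫⁻ x in D, ‖u k (x, 0) - g x‖ₑ ^ 2) atTop (𝓝 0) :=
    tendsto_of_tendsto_of_tendsto_of_le_of_le tendsto_const_nhds
      (tendsto_lintegral_sq_zero htrace) (fun _ => zero_le)
      fun k => lintegral_mono_set hξ
  have hc2 : Tendsto (fun k => ∫⁻ x in A, ‖u k (x, 0) - g x‖ₑ ^ 2) atTop (𝓝 0) :=
    tendsto_of_tendsto_of_tendsto_of_le_of_le tendsto_const_nhds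
      hc1 (fun _ => zero_le) fun k => lintegral_mono_set hA
  have hc3 : Tendsto (fun k => ∫⁻ p in P, ‖classicalGrad (u k) p - G p‖ₑ ^ 2) atTop (𝓝 0) :=
    tendsto_of_tendsto_of_tendsto_of_le_of_le tendsto_const_nhds
      (tendsto_lintegral_sq_zero hgrad) (fun _ => zero_le)
      fun k => lintegral_mono_set hU
  have hum : ∀ k, Measurable fun x : Plane => ‖u k (x, 0)‖ₑ ^ 2 := fun k =>
    Measurable.pow_const (Continuous.measurable (by have := (hu k).continuous; fun_prop)) 2
  have hG' : AEMeasurable (fun p => ‖G p‖ₑ ^ 2) (volume.restrict P) :=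
    (hGU.mono_measure (Measure.restrict_mono hU le_rfl)).enorm.pow_const 2
  set r := ENNReal.ofReal ρ
  -- Everything that depends on `k` is an error term tending to `0`. The two passages between limit
  -- and approximant each cost a factor `2`, whence `432 = 4 · 108`.
  have key : ∀ k, θ * ∫⁻ x in D, ‖g x‖ₑ ^ 2 ≤
      2 * (2 * (∫⁻ x in A, ‖u k (x, 0) - g x‖ₑ ^ 2) +
        108 * r * (2 * ((∫⁻ p in P, ‖G p‖ₑ ^ 2) +
          ∫⁻ p in P, ‖classicalGrad (u k) p - G p‖ₑ ^ 2))) +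
        2 * θ * ∫⁻ x in D, ‖u k (x, 0) - g x‖ₑ ^ 2 := by
    intro k
    have h1 : ∫⁻ x in D, ‖g x‖ₑ ^ 2 ≤ 2 * ((∫⁻ x in D, ‖u k (x, 0)‖ₑ ^ 2) +
        ∫⁻ x in D, ‖u k (x, 0) - g x‖ₑ ^ 2) := by
      rw [← lintegral_add_left (hum k), ← lintegral_const_mul' _ _ (by simp)]
      refine lintegral_mono fun x => ?_
      rw [← enorm_neg (u k (x, 0) - g x), neg_sub]
      exact enorm_sq_le_two _ _
    have h2 : ∫⁻ x in A, ‖u k (x, 0)‖ₑ ^ 2 = ∫⁻ x in A, ‖u k (x, 0) - g x‖ₑ ^ 2 := by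
      refine lintegral_congr_ae ?_
      filter_upwards [hgA] with x hx
      simp [hx]
    have h3 : ∫⁻ p in P, ‖classicalGrad (u k) p‖ₑ ^ 2 ≤ 2 * ((∫⁻ p in P, ‖G p‖ₑ ^ 2) +
        ∫⁻ p in P, ‖classicalGrad (u k) p - G p‖ₑ ^ 2) := by
      rw [← lintegral_add_left' hG', ← lintegral_const_mul' _ _ (by simp)]
      exact lintegral_mono fun p => enorm_sq_le_two _ _
    have h4 := smooth_trace_poincare (hu k) hρ hS hSs hSm ξ hA hθ
    rw [h2] at h4
    calc θ * ∫⁻ x in D, ‖g x‖ₑ ^ 2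
        ≤ θ * (2 * ((∫⁻ x in D, ‖u k (x, 0)‖ₑ ^ 2) +
          ∫⁻ x in D, ‖u k (x, 0) - g x‖ₑ ^ 2)) := by gcongr
      _ = 2 * (θ * ∫⁻ x in D, ‖u k (x, 0)‖ₑ ^ 2) +
          2 * θ * ∫⁻ x in D, ‖u k (x, 0) - g x‖ₑ ^ 2 := by ring
      _ ≤ _ := by
        gcongr
        refine h4.trans ?_
        gcongr
  have hlim : Tendsto (fun k => 2 * (2 * (∫⁻ x in A, ‖u k (x, 0) - g x‖ₑ ^ 2) +
        108 * r * (2 * ((∫⁻ p in P, ‖G p‖ₑ ^ 2) +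
          ∫⁻ p in P, ‖classicalGrad (u k) p - G p‖ₑ ^ 2))) +
        2 * θ * ∫⁻ x in D, ‖u k (x, 0) - g x‖ₑ ^ 2) atTop
      (𝓝 (2 * (2 * 0 + 108 * r * (2 * ((∫⁻ p in P, ‖G p‖ₑ ^ 2) + 0))) + 2 * θ * 0)) := by
    have hr : r ≠ ⊤ := ENNReal.ofReal_ne_top
    have h108 : 108 * r ≠ ⊤ := ENNReal.mul_ne_top (by simp) hr
    have h2θ : 2 * θ ≠ ⊤ := ENNReal.mul_ne_top (by simp) hθt
    refine .add (ENNReal.Tendsto.const_mul (.add (ENNReal.Tendsto.const_mul hc2 (.inr (by simp)))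
      (ENNReal.Tendsto.const_mul (ENNReal.Tendsto.const_mul (.add tendsto_const_nhds hc3)
        (.inr (by simp))) (.inr h108))) (.inr (by simp)))
      (ENNReal.Tendsto.const_mul hc1 (.inr h2θ))
  refine (ge_of_tendsto' hlim key).trans (le_of_eq ?_)
  ring

end Poincare

/-! ### Packing of equal disks in a disk -/

section DiskGeometry

theorem rank_plane : 1 < Module.rank ℝ Plane := by
  rw [← Module.finrank_eq_rank]
  simp

theorem norm_add_le_of_disk_subset {ξ : Plane} {ρ R : ℝ} (hρ : 0 < ρ)
    (h : disk ξ ρ ⊆ crossSection R) : ‖ξ‖ + ρ ≤ R := by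
  obtain ⟨e, he, hξ⟩ : ∃ e : Plane, ‖e‖ = 1 ∧ ξ = ‖ξ‖ • e := by
    by_cases h0 : ξ = 0
    · exact ⟨EuclideanSpace.single 0 1, by simp, by simp [h0]⟩
    · exact ⟨‖ξ‖⁻¹ • ξ, by simp [norm_smul, h0], by simp [smul_smul, h0]⟩
  -- Points `a • e` on the ray through `ξ`, with `a` up to `‖ξ‖ + ρ`, stay in the inner disk and
  -- hence in `D(0, R)`.
  refine le_of_forall_lt_imp_le_of_dense fun a ha => ?_
  by_cases hn : a < ‖ξ‖
  · have := h (Metric.mem_ball_self hρ)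
    exact (hn.trans (by simpa using this)).le
  · have hm : ξ + (a - ‖ξ‖) • e ∈ disk ξ ρ := by
      simp only [disk, Metric.mem_ball, dist_self_add_left, norm_smul, he, Real.norm_eq_abs]
      rw [abs_of_nonneg (by linarith)]; linarith
    have h2 := h hm
    rw [show ξ + (a - ‖ξ‖) • e = a • e by rw [sub_smul, ← hξ]; abel] at h2
    simp only [crossSection, disk, norm_smul, he, mul_one, mem_ball_zero_iff,
      Real.norm_eq_abs] at h2
    exact (lt_of_abs_lt h2).le

/-- Disjoint circles of the same radius bound disjoint disks. -/
theorem two_mul_le_dist_of_frontier_disjoint {x y : Plane} {ρ : ℝ} (hρ : 0 < ρ)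
    (h : frontier (disk x ρ) ∩ frontier (disk y ρ) = ∅) : 2 * ρ ≤ dist x y := by
  rw [frontier_ball _ hρ.ne', frontier_ball _ hρ.ne'] at h
  by_contra! hd
  obtain ⟨e, he, hxy⟩ : ∃ e : Plane, ‖e‖ = 1 ∧ y - x = dist x y • e := by
    by_cases h0 : y - x = 0
    · have : x = y := (sub_eq_zero.1 h0).symm
      exact ⟨EuclideanSpace.single 0 1, by simp, by simp [this]⟩
    · refine ⟨‖y - x‖⁻¹ • (y - x), by simp [norm_smul, h0], ?_⟩
      rw [dist_comm, dist_eq_norm]; simp [smul_smul, h0]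
  have hpre := isPreconnected_sphere rank_plane x ρ
  have hd0 : 0 ≤ dist x y := dist_nonneg
  have hcalc : ∀ t : ℝ, dist (x + t • e) y = |t - dist x y| := by
    intro t
    rw [dist_eq_norm, show x + t • e - y = (t - dist x y) • e by
      rw [sub_smul, ← hxy]; abel, norm_smul, he, mul_one, Real.norm_eq_abs]
  have hm : ∀ t : ℝ, |t| = ρ → x + t • e ∈ Metric.sphere x ρ := by
    intro t ht
    simp [norm_smul, he, ht]
  -- If `d = dist x y < 2ρ`, the distance to `y` on the circle about `x` takes the values `|ρ - d| ≤
  -- ρ` and `ρ + d ≥ ρ`. Connectedness of the circle gives a point at distance exactly `ρ`, common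
  -- to both circles; coincident centers are included.
  have hiv := hpre.intermediate_value (f := fun z => dist z y)
    (hm ρ (abs_of_pos hρ)) (hm (-ρ) (by rw [abs_neg, abs_of_pos hρ])) (by fun_prop)
  have hmem : ρ ∈ Icc (dist (x + ρ • e) y) (dist (x + (-ρ) • e) y) := by
    rw [hcalc, hcalc]
    constructor
    · rw [abs_le]; constructor <;> linarith
    · rw [abs_sub_comm]; exact le_trans (by linarith) (le_abs_self _)
  obtain ⟨z, hz, hz2⟩ := hiv hmem
  exact (h ▸ (⟨hz, hz2⟩ : z ∈ Metric.sphere x ρ ∩ Metric.sphere y ρ) : z ∈ (∅ : Set Plane))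

/-- Equality would force `ξ = 0`, and then the two boundary circles coincide. -/
theorem radius_lt_of_frontier_disjoint {ξ : Plane} {ρ R : ℝ} (hρ : 0 < ρ)
    (h : disk ξ ρ ⊆ crossSection R)
    (hf : frontier (disk ξ ρ) ∩ frontier (crossSection R) = ∅) : ρ < R := by
  have h1 := norm_add_le_of_disk_subset hρ h
  refine lt_of_le_of_ne (by linarith [norm_nonneg ξ]) fun hρR => ?_
  subst hρR
  have : ξ = 0 := norm_le_zero_iff.1 (by linarith)
  subst this
  have := two_mul_le_dist_of_frontier_disjoint hρ hf
  rw [dist_self] at this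
  linarith

/-- A disk in `D(0, R)` that comes close to `p ∈ ∂D(0, R)` has its center near `(1 - ρ / R) p`. -/
theorem norm_center_sub_sq_le {ξ p x : Plane} {ρ R η : ℝ} (hρ : ‖ξ‖ + ρ ≤ R)
    (hρR : ρ < R) (hR : 0 < R) (hp : ‖p‖ = R) (hx : dist x ξ < ρ) (hxp : dist x p < η) :
    ‖R • ξ - (R - ρ) • p‖ ^ 2 ≤ 2 * R ^ 2 * (R - ρ) * η := by
  have h1 : |inner ℝ (x - p) p| ≤ ‖x - p‖ * ‖p‖ := abs_real_inner_le_norm _ _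
  have h2 : |inner ℝ (x - ξ) p| ≤ ‖x - ξ‖ * ‖p‖ := abs_real_inner_le_norm _ _
  rw [← dist_eq_norm, hp] at h1 h2
  rw [inner_sub_left, real_inner_self_eq_norm_sq, hp] at h1
  rw [inner_sub_left] at h2
  -- Since `x` is near both `p` and `ξ`, the component of `ξ` along `p` is almost as large as `‖ξ‖ ≤
  -- R - ρ` permits; expanding the square then leaves only the defect `η`.
  have h3 : R * (R - ρ - η) ≤ inner ℝ ξ p := by
    have := (abs_le.1 h1).1
    have := (abs_le.1 h2).2
    nlinarith
  rw [norm_sub_sq_real, norm_smul, norm_smul, real_inner_smul_left, real_inner_smul_right, hp,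
    Real.norm_eq_abs, Real.norm_eq_abs, abs_of_pos hR, abs_of_pos (sub_pos.2 hρR)]
  have h4 : ‖ξ‖ ^ 2 ≤ (R - ρ) ^ 2 := by
    have := norm_nonneg ξ
    gcongr
    linarith
  have h5 : 0 < R * (R - ρ) := mul_pos hR (sub_pos.2 hρR)
  nlinarith [mul_le_mul_of_nonneg_left h3 h5.le, mul_le_mul_of_nonneg_left h4 (sq_nonneg R)]

/-- A disk well inside `D(0, R)` cannot come close to two distant points of the boundary. -/
theorem dist_sq_le_of_disk_near {ξ p q x y : Plane} {ρ ρ₁ R η : ℝ} (hρ : ‖ξ‖ + ρ ≤ R)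
    (hρ₁ : ρ ≤ ρ₁) (hρR : ρ₁ < R) (hR : 0 < R) (hp : ‖p‖ = R) (hq : ‖q‖ = R)
    (hx : dist x ξ < ρ) (hxp : dist x p < η) (hy : dist y ξ < ρ) (hyq : dist y q < η) :
    (R - ρ₁) * dist p q ^ 2 ≤ 8 * R ^ 2 * η := by
  have h1 := norm_center_sub_sq_le hρ (hρ₁.trans_lt hρR) hR hp hx hxp
  have h2 := norm_center_sub_sq_le hρ (hρ₁.trans_lt hρR) hR hq hy hyq
  have hpos : 0 < R - ρ := by linarith
  have h3 : (R - ρ) * dist p q ≤ ‖R • ξ - (R - ρ) • p‖ + ‖R • ξ - (R - ρ) • q‖ := by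
    rw [dist_eq_norm]
    calc (R - ρ) * ‖p - q‖ = ‖(R • ξ - (R - ρ) • q) - (R • ξ - (R - ρ) • p)‖ := by
          rw [sub_sub_sub_cancel_left, ← smul_sub, norm_smul, Real.norm_eq_abs,
            abs_of_pos hpos]
      _ ≤ _ := (norm_sub_le _ _).trans (add_comm _ _).le
  have h4 : ((R - ρ) * dist p q) ^ 2 ≤ (R - ρ) * (8 * R ^ 2 * η) := by
    have h5 : 0 ≤ (R - ρ) * dist p q := by positivity
    nlinarith [sq_nonneg (‖R • ξ - (R - ρ) • p‖ - ‖R • ξ - (R - ρ) • q‖)]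
  have h6 : (R - ρ) * dist p q ^ 2 ≤ 8 * R ^ 2 * η := by
    refine le_of_mul_le_mul_left ?_ hpos
    calc _ = ((R - ρ) * dist p q) ^ 2 := by ring
      _ ≤ _ := h4
  refine le_trans ?_ h6
  gcongr

theorem card_mul_sq_le_of_disjoint {N : ℕ} {ξ : ℕ → Plane} {ρ R : ℝ} (hρ : 0 < ρ) (hR : 0 < R)
    (hsub : ∀ n ∈ Finset.Icc 1 N, disk (ξ n) ρ ⊆ crossSection R)
    (hdisj : (Finset.Icc 1 N : Set ℕ).PairwiseDisjoint fun n => disk (ξ n) ρ) :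
    N * ρ ^ 2 ≤ R ^ 2 := by
  have h1 : volume (⋃ n ∈ Finset.Icc 1 N, disk (ξ n) ρ) ≤ volume (crossSection R) :=
    measure_mono (iUnion₂_subset hsub)
  rw [measure_biUnion_finset hdisj fun n _ => Metric.isOpen_ball.measurableSet] at h1
  simp only [EuclideanSpace.volume_ball_fin_two, Finset.sum_const, Nat.card_Icc, crossSection,
    add_tsub_cancel_right, nsmul_eq_mul, ← mul_assoc] at h1
  rw [ENNReal.mul_le_mul_iff_left (by simp [Real.pi_pos]) (by simp)] at h1
  rw [← ENNReal.ofReal_pow hρ.le, ← ENNReal.ofReal_pow hR.le, ← ENNReal.ofReal_natCast,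
    ← ENNReal.ofReal_mul (by positivity), ENNReal.ofReal_le_ofReal_iff (by positivity)] at h1
  exact h1

/-- Disjoint disks of the same radius `ρ ∈ [ρ₀, ρ₁]`, `ρ₁ < R`, leave free a fixed fraction of
`D(0, R)`. -/
theorem exists_uncovered_fraction {R ρ₀ ρ₁ : ℝ} (hR : 0 < R) (hρ₀ : 0 < ρ₀) (hρ₁ : ρ₁ < R) :
    ∃ θ : ℝ, 0 < θ ∧ ∀ (ρ : ℝ) (N : ℕ) (ξ : ℕ → Plane), ρ₀ ≤ ρ → ρ ≤ ρ₁ →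
      (∀ n ∈ Finset.Icc 1 N, disk (ξ n) ρ ⊆ crossSection R) →
      (Finset.Icc 1 N : Set ℕ).PairwiseDisjoint (fun n => disk (ξ n) ρ) →
      ENNReal.ofReal θ * volume (crossSection R) ≤
        volume (crossSection R \ ⋃ n ∈ Finset.Icc 1 N, disk (ξ n) ρ) := by
  -- By areas there are fewer than `M` disks. With `M` separated points on the circle of radius `R`,
  -- and each disk able to come `η`-close to at most one of them, some point stays free.
  obtain ⟨M, hM⟩ := exists_nat_gt (R ^ 2 / ρ₀ ^ 2)
  rw [div_lt_iff₀ (by positivity)] at hM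
  have hinf : (Metric.sphere (0 : Plane) R).Infinite := by
    refine (isPreconnected_sphere rank_plane 0 R).infinite_of_nontrivial ?_
    refine ⟨EuclideanSpace.single 0 R, by simp [hR.le], EuclideanSpace.single 0 (-R),
      by simp [hR.le], fun h => ?_⟩
    have := congrArg (fun v : Plane => v 0) h
    simp at this
    linarith
  obtain ⟨P, hPs, hPc⟩ := hinf.exists_subset_card_eq M
  obtain ⟨δ, hδ, hsep⟩ : ∃ δ > 0, ∀ p ∈ P, ∀ q ∈ P, p ≠ q → δ ≤ dist p q := by
    by_cases h : (P.offDiag).Nonempty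
    · obtain ⟨z, hz, hmin⟩ := P.offDiag.exists_min_image (fun z => dist z.1 z.2) h
      refine ⟨dist z.1 z.2, dist_pos.2 (Finset.mem_offDiag.1 hz).2.2, fun p hp q hq hpq => ?_⟩
      exact hmin (p, q) (Finset.mem_offDiag.2 ⟨hp, hq, hpq⟩)
    · refine ⟨1, one_pos, fun p hp q hq hpq => (h ⟨(p, q), ?_⟩).elim⟩
      exact Finset.mem_offDiag.2 ⟨hp, hq, hpq⟩
  have hgap : 0 < R - ρ₁ := sub_pos.2 hρ₁
  -- The second bound makes `8 R² η < (R - ρ₁) δ²`, contradicting `dist_sq_le_of_disk_near` for two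
  -- `δ`-separated points; the first keeps the free disk below inside `D(0, R)`.
  set η := min R ((R - ρ₁) * δ ^ 2 / (16 * R ^ 2)) with hη
  have hη0 : 0 < η := by positivity
  have hηR : η ≤ R := min_le_left _ _
  have hηδ : 8 * R ^ 2 * η < (R - ρ₁) * δ ^ 2 := by
    have : η ≤ (R - ρ₁) * δ ^ 2 / (16 * R ^ 2) := min_le_right _ _
    rw [le_div_iff₀ (by positivity)] at this
    nlinarith [mul_pos hη0 (pow_pos hR 2)]
  refine ⟨η ^ 2 / (4 * R ^ 2), by positivity, fun ρ N ξ hρ0 hρ1 hsub hdisj => ?_⟩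
  have hρ : 0 < ρ := hρ₀.trans_le hρ0
  have hNM : N < M := by
    have h1 := card_mul_sq_le_of_disjoint hρ hR hsub hdisj
    have h2 : (N : ℝ) * ρ₀ ^ 2 ≤ N * ρ ^ 2 := by gcongr
    exact_mod_cast lt_of_mul_lt_mul_right ((h2.trans h1).trans_lt hM) (by positivity)
  obtain ⟨p, hpP, hp⟩ : ∃ p ∈ P, ∀ n ∈ Finset.Icc 1 N,
      Disjoint (disk p η) (disk (ξ n) ρ) := by
    by_contra! hcon
    choose! f hf hfd using hcon
    obtain ⟨p, hp, q, hq, hpq, hfe⟩ := Finset.exists_ne_map_eq_of_card_lt_of_maps_to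
      (s := P) (t := Finset.Icc 1 N) (by simpa [hPc] using hNM) hf
    obtain ⟨x, hxp, hxξ⟩ := not_disjoint_iff.1 (hfd p hp)
    obtain ⟨y, hyq, hyξ⟩ := not_disjoint_iff.1 (hfd q hq)
    rw [← hfe] at hyξ
    have hle := dist_sq_le_of_disk_near
      (norm_add_le_of_disk_subset hρ (hsub _ (hf p hp))) hρ1 hρ₁ hR
      (by simpa using hPs hp) (by simpa using hPs hq) hxξ hxp hyξ hyq
    have hge : (R - ρ₁) * δ ^ 2 ≤ (R - ρ₁) * dist p q ^ 2 := by
      have := hsep p hp q hq hpq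
      gcongr
    linarith
  have hpn : ‖p‖ = R := by simpa using hPs hpP
  -- Moving `p` inwards by `η / 2` gives a disk of radius `η / 2` that lies both in `D(0, R)` and in
  -- the free disk `D(p, η)`.
  have hball : disk ((1 - η / (2 * R)) • p) (η / 2) ⊆
      crossSection R \ ⋃ n ∈ Finset.Icc 1 N, disk (ξ n) ρ := by
    have hfr : η / (2 * R) ≤ 1 := by rw [div_le_one (by positivity)]; linarith
    have hmul : η / (2 * R) * R = η / 2 := by field_simp
    refine subset_sdiff.2 ⟨Metric.ball_subset_ball' ?_, ?_⟩
    · rw [dist_zero_right, norm_smul, hpn, Real.norm_eq_abs, abs_of_nonneg (by linarith)]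
      linarith
    · refine Disjoint.mono_left (Metric.ball_subset_ball' (y := p) (ε₂ := η) ?_)
        (disjoint_iUnion₂_right.2 hp)
      rw [dist_eq_norm, sub_smul, one_smul, sub_sub_cancel_left, norm_neg, norm_smul, hpn,
        Real.norm_eq_abs, abs_of_pos (by positivity), hmul]
      linarith
  refine le_trans (le_of_eq ?_) (measure_mono hball)
  rw [EuclideanSpace.volume_ball_fin_two, EuclideanSpace.volume_ball_fin_two, ← mul_assoc,
    ← ENNReal.ofReal_pow hR.le, ← ENNReal.ofReal_mul (by positivity),
    ← ENNReal.ofReal_pow (by positivity)]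
  congr 2
  field_simp
  ring

end DiskGeometry

/-! ### Lower bound for the levels with large perforations -/

/-- If `δ₀ r_ε ≤ δ₁ ε` for all `ε ≤ ε_*`, the ratio `r_ε / ε` can only be close to its bound when
`ε` is bounded below, uniformly in the exponent `α`. -/
theorem exists_lower_bound_scale {δ₀ δ₁ εs : ℝ} (hδ₀ : 0 < δ₀) (hδ₁ : 0 < δ₁) (hεs : 0 < εs) :
    ∃ ε₀ : ℝ, 0 < ε₀ ∧ ∀ α : ℝ,
      (∀ ε ∈ Ioc 0 εs, δ₀ * holeScale α ε ≤ δ₁ * ε) →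
      ∀ ε ∈ Ioc 0 εs, δ₁ * ε < 2 * (δ₀ * holeScale α ε) → ε₀ ≤ ε := by
  set c := δ₁ / δ₀ with hc
  have hc0 : 0 < c := by positivity
  set b := |Real.log c| + 1 with hb
  have hb1 : 1 ≤ b := by simp [hb]
  refine ⟨min (εs ^ 2) (Real.exp (-(8 * b + 4))), by positivity, fun α hall ε hε hlt => ?_⟩
  by_contra! hsmall
  obtain ⟨h1, h2⟩ := lt_min_iff.1 hsmall
  have hε0 := hε.1
  have hlog : Real.log ε < -(8 * b + 4) := (Real.log_lt_iff_lt_exp hε0).2 h2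
  -- The bound `εs ^ 2` in the witness makes `√ε` an admissible level. There the exponent is `Y`,
  -- while at `ε` it is `Y ^ 2`, for every `α`.
  have hsq : √ε ∈ Ioc 0 εs := ⟨Real.sqrt_pos.2 hε0, (Real.sqrt_le_left hεs.le).2 h1.le⟩
  have h3 := hall _ hsq
  set Y := (√ε) ^ (-α) with hY
  have hX : ε ^ (-α) = Y ^ 2 := by
    rw [hY, ← Real.rpow_natCast, ← Real.rpow_mul (Real.sqrt_nonneg _), mul_comm,
      Real.rpow_mul (Real.sqrt_nonneg _)]
    simp [Real.sq_sqrt hε0.le]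
  have h4 : Real.log c + Real.log ε - 1 < -Y ^ 2 := by
    have h5 : c * ε < 2 * Real.exp (-Y ^ 2) := by
      rw [holeScale, hX] at hlt
      rw [hc, div_mul_eq_mul_div, div_lt_iff₀ hδ₀]
      linarith
    have h6 := Real.log_lt_log (by positivity) h5
    rw [Real.log_mul hc0.ne' hε0.ne', Real.log_mul (by norm_num) (Real.exp_ne_zero _),
      Real.log_exp] at h6
    have := Real.log_two_lt_d9
    linarith
  have h7 : -Y ≤ Real.log c + Real.log ε / 2 := by
    have h5 : Real.exp (-Y) ≤ c * √ε := by
      rw [holeScale, ← hY] at h3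
      rw [hc, div_mul_eq_mul_div, le_div_iff₀ hδ₀]
      linarith
    have h6 := Real.log_le_log (Real.exp_pos _) h5
    rwa [Real.log_mul hc0.ne' hsq.1.ne', Real.log_exp, Real.log_sqrt hε0.le] at h6
  have hlc := neg_abs_le (Real.log c)
  have hlc' := le_abs_self (Real.log c)
  -- Level `√ε` gives `Y ≥ y`, and level `ε` gives `Y² < 2y + 3b`. These are incompatible once `y ≥
  -- 3b + 2`, which is what the exponent `8 * b + 4` provides.
  set y := -(Real.log ε) / 2 - b with hy
  have hy1 : 3 * b + 2 ≤ y := by rw [hy]; linarith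
  have hyY : y ≤ Y := by rw [hy, hb]; linarith
  have hY2 : Y ^ 2 < 2 * y + 3 * b := by rw [hy, hb]; linarith
  have : y ^ 2 ≤ Y ^ 2 := by gcongr; linarith
  nlinarith

/-! ### The two sides of the sieve -/

/-- One-sided intervals `T ρ` of length `ρ` ending at `0`, such as `(0, ρ)` or `(-ρ, 0)`. -/
structure IsOneSided (T : ℝ → Set ℝ) : Prop where
  measurableSet : ∀ ρ, MeasurableSet (T ρ)
  volume_eq : ∀ ρ, volume (T ρ) = ENNReal.ofReal ρ
  restrict_le : ∀ ρ, ∀ s ∈ T ρ, |s| ≤ ρ ∧ volume.restrict (uIoc 0 s) ≤ volume.restrict (T ρ)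

theorem isOneSided_upper : IsOneSided fun ρ => Ioo 0 ρ where
  measurableSet _ := measurableSet_Ioo
  volume_eq ρ := by simp
  restrict_le ρ s hs := by
    refine ⟨by rw [abs_of_pos hs.1]; exact hs.2.le, Measure.restrict_mono ?_ le_rfl⟩
    rw [uIoc_of_le hs.1.le]
    exact fun t ht => ⟨ht.1, ht.2.trans_lt hs.2⟩

theorem isOneSided_lower : IsOneSided fun ρ => Ioo (-ρ) 0 where
  measurableSet _ := measurableSet_Ioo
  volume_eq ρ := by simp
  restrict_le ρ s hs := by
    refine ⟨by rw [abs_of_neg hs.2]; linarith [hs.1], ?_⟩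
    -- Here `uIoc 0 s` contains the endpoint `0`, which is not in `Ioo (-ρ) 0`. Comparing restricted
    -- measures instead of sets ignores this null point.
    rw [uIoc_of_ge hs.2.le, ← restrict_Ioo_eq_restrict_Ioc]
    exact Measure.restrict_mono (Ioo_subset_Ioo_left hs.1.le) le_rfl

/-! ### The estimate for small holes and for a free fraction -/

section Estimates

variable {F : Type} [NormedAddCommGroup F] [InnerProductSpace ℝ F] [CompleteSpace F]
  {R : ℝ} {T : ℝ → Set ℝ} {U : Set Space3} {φ : Space3 → F} {G : Space3 → GradVal F}
  {g : Plane → F}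

/-- Perforations contained in the half-size concentric disks of a disjoint family. -/
theorem trace_estimate_of_small_holes (hT : IsOneSided T)
    (hTU : ∀ ρ, 0 < ρ → ρ ≤ R → crossSection R ×ˢ T ρ ⊆ U)
    (hGU : AEStronglyMeasurable G (volume.restrict U)) (htr : IsTrace R U φ G g)
    {a ρ : ℝ} (ha : 0 < a) (haρ : 2 * a ≤ ρ) (hρR : ρ ≤ R) {N : ℕ} {ξ : ℕ → Plane}
    (hsub : ∀ n ∈ Finset.Icc 1 N, disk (ξ n) ρ ⊆ crossSection R)
    (hdisj : (Finset.Icc 1 N : Set ℕ).PairwiseDisjoint fun n => disk (ξ n) ρ)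
    (hg : ∀ᵐ x ∂(volume.restrict (crossSection R \ ⋃ n ∈ Finset.Icc 1 N, disk (ξ n) a)),
      g x = 0) :
    ∫⁻ x in crossSection R, ‖g x‖ₑ ^ 2 ≤
      1728 * ENNReal.ofReal a * ∫⁻ p in U, ‖G p‖ₑ ^ 2 := by
  have hbig : ∀ n, disk (ξ n) (2 * a) ⊆ disk (ξ n) ρ := fun n => Metric.ball_subset_ball haρ
  have hsmall : ∀ n, disk (ξ n) a ⊆ disk (ξ n) (2 * a) := fun n =>
    Metric.ball_subset_ball (by linarith)
  have h2a : ENNReal.ofReal (2 * a) = 2 * ENNReal.ofReal a := by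
    rw [ENNReal.ofReal_mul (by norm_num)]; simp
  have hone : ∀ n ∈ Finset.Icc 1 N, ∫⁻ x in disk (ξ n) (2 * a), ‖g x‖ₑ ^ 2 ≤
      1728 * ENNReal.ofReal a * ∫⁻ p in disk (ξ n) (2 * a) ×ˢ T (2 * a), ‖G p‖ₑ ^ 2 := by
    intro n hn
    have hann : disk (ξ n) (2 * a) \ disk (ξ n) a ⊆
        crossSection R \ ⋃ n ∈ Finset.Icc 1 N, disk (ξ n) a := by
      refine fun x hx => ⟨hsub n hn (hbig n hx.1), ?_⟩
      simp only [mem_iUnion, not_exists]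
      intro m hm hxm
      by_cases hmn : m = n
      · exact hx.2 (hmn ▸ hxm)
      · exact disjoint_left.1 (hdisj hm hn hmn) (hbig m (hsmall m hxm)) (hbig n hx.1)
    have hpos : (0 : ℝ) < 2 * a := by linarith
    -- The annulus fills three quarters of the disk; one half is enough. The constant is then `1728
    -- = 2 · 432 · 2`, the last factor coming from the radius `2 * a`.
    have hvol : (2 : ℝ≥0∞)⁻¹ * volume (disk (ξ n) (2 * a)) ≤
        volume (disk (ξ n) (2 * a) \ disk (ξ n) a) := by
      rw [measure_sdiff (hsmall n) Metric.isOpen_ball.nullMeasurableSet measure_ball_lt_top.ne,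
        EuclideanSpace.volume_ball_fin_two, EuclideanSpace.volume_ball_fin_two, h2a]
      refine ENNReal.le_sub_of_add_le_left (ENNReal.mul_ne_top (by simp) (by simp)) ?_
      calc _ = ENNReal.ofReal a ^ 2 * ENNReal.ofReal Real.pi + 2⁻¹ * 2 *
            (2 * (ENNReal.ofReal a ^ 2 * ENNReal.ofReal Real.pi)) := by ring
        _ = 3 * (ENNReal.ofReal a ^ 2 * ENNReal.ofReal Real.pi) := by
          rw [ENNReal.inv_mul_cancel (by simp) (by simp)]; ring
        _ ≤ 4 * (ENNReal.ofReal a ^ 2 * ENNReal.ofReal Real.pi) := by gcongr; norm_num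
        _ = _ := by ring
    have h := trace_poincare hpos (hT.volume_eq _) (hT.restrict_le _) (hT.measurableSet _)
      ((hbig n).trans (hsub n hn))
      ((prod_mono_left ((hbig n).trans (hsub n hn))).trans (hTU _ hpos (haρ.trans hρR)))
      hGU htr (sdiff_subset) (ae_restrict_of_ae_restrict_of_subset hann hg) (by simp) hvol
    calc _ = 2 * (2⁻¹ * ∫⁻ x in disk (ξ n) (2 * a), ‖g x‖ₑ ^ 2) := by
          rw [← mul_assoc, ENNReal.mul_inv_cancel (by simp) (by simp), one_mul]
      _ ≤ 2 * (432 * ENNReal.ofReal (2 * a) *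
            ∫⁻ p in disk (ξ n) (2 * a) ×ˢ T (2 * a), ‖G p‖ₑ ^ 2) := by gcongr
      _ = _ := by rw [h2a]; ring
  set H := ⋃ n ∈ Finset.Icc 1 N, disk (ξ n) a with hH
  have hHm : MeasurableSet H :=
    Finset.measurableSet_biUnion _ fun n _ => Metric.isOpen_ball.measurableSet
  have hdisj2 : (Finset.Icc 1 N : Set ℕ).PairwiseDisjoint fun n => disk (ξ n) (2 * a) :=
    hdisj.mono_on fun n _ => hbig n
  have hTm := hT.measurableSet (2 * a)
  calc ∫⁻ x in crossSection R, ‖g x‖ₑ ^ 2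
      = (∫⁻ x in crossSection R ∩ H, ‖g x‖ₑ ^ 2) +
          ∫⁻ x in crossSection R \ H, ‖g x‖ₑ ^ 2 := (lintegral_inter_add_sdiff _ _ hHm).symm
    _ = ∫⁻ x in crossSection R ∩ H, ‖g x‖ₑ ^ 2 := by
        have h0 : ∫⁻ x in crossSection R \ H, ‖g x‖ₑ ^ 2 = 0 := by
          refine (lintegral_congr_ae ?_).trans lintegral_zero
          filter_upwards [hg] with x hx
          simp [hx]
        rw [h0, add_zero]
    _ ≤ ∫⁻ x in ⋃ n ∈ Finset.Icc 1 N, disk (ξ n) (2 * a), ‖g x‖ₑ ^ 2 :=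
        lintegral_mono_set (inter_subset_right.trans (iUnion₂_mono fun n _ => hsmall n))
    _ = ∑ n ∈ Finset.Icc 1 N, ∫⁻ x in disk (ξ n) (2 * a), ‖g x‖ₑ ^ 2 :=
        lintegral_biUnion_finset hdisj2 (fun n _ => Metric.isOpen_ball.measurableSet) _
    _ ≤ ∑ n ∈ Finset.Icc 1 N, 1728 * ENNReal.ofReal a *
          ∫⁻ p in disk (ξ n) (2 * a) ×ˢ T (2 * a), ‖G p‖ₑ ^ 2 := Finset.sum_le_sum hone
    _ = 1728 * ENNReal.ofReal a *
          ∫⁻ p in ⋃ n ∈ Finset.Icc 1 N, disk (ξ n) (2 * a) ×ˢ T (2 * a), ‖G p‖ₑ ^ 2 := by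
        rw [← Finset.mul_sum, lintegral_biUnion_finset]
        · exact fun m hm n hn hmn => disjoint_prod.2 (.inl (hdisj2 hm hn hmn))
        · exact fun n _ => Metric.isOpen_ball.measurableSet.prod hTm
    _ ≤ _ := by
        gcongr
        exact iUnion₂_subset fun n hn => (prod_mono_left ((hbig n).trans (hsub n hn))).trans
          (hTU _ (by linarith) (haρ.trans hρR))

/-- The trace vanishes on a fixed fraction of the cross-section. -/
theorem trace_estimate_of_fraction (hT : IsOneSided T) (hR : 0 < R)
    (hTU : ∀ ρ, 0 < ρ → ρ ≤ R → crossSection R ×ˢ T ρ ⊆ U)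
    (hGU : AEStronglyMeasurable G (volume.restrict U)) (htr : IsTrace R U φ G g)
    {A : Set Plane} (hA : A ⊆ crossSection R) {θ : ℝ} (hθ : 0 < θ)
    (hAθ : ENNReal.ofReal θ * volume (crossSection R) ≤ volume A)
    (hg : ∀ᵐ x ∂(volume.restrict A), g x = 0) :
    ∫⁻ x in crossSection R, ‖g x‖ₑ ^ 2 ≤
      ENNReal.ofReal (432 * R / θ) * ∫⁻ p in U, ‖G p‖ₑ ^ 2 := by
  have h := trace_poincare hR (hT.volume_eq _) (hT.restrict_le _) (hT.measurableSet _)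
    Subset.rfl (hTU R hR le_rfl) hGU htr hA hg ENNReal.ofReal_ne_top hAθ
  have h2 : ∫⁻ p in disk 0 R ×ˢ T R, ‖G p‖ₑ ^ 2 ≤ ∫⁻ p in U, ‖G p‖ₑ ^ 2 :=
    lintegral_mono_set (hTU R hR le_rfl)
  have hθ0 : ENNReal.ofReal θ ≠ 0 := by simpa using hθ
  rw [← ENNReal.mul_le_mul_iff_right hθ0 ENNReal.ofReal_ne_top, ← mul_assoc,
    ← ENNReal.ofReal_mul hθ.le, mul_div_cancel₀ _ hθ.ne', ENNReal.ofReal_mul (by norm_num)]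
  refine h.trans ?_
  simp only [ENNReal.ofReal_ofNat]
  gcongr

end Estimates

/-! ### Consequences of admissibility of the perforations -/

section Perforations

variable {R h r : ℝ} {K : ℕ → Set Plane} {N : ℕ} {ξ : ℕ → Plane}

theorem closure_place_subset {A : Set Plane} (hA : Bornology.IsBounded A) (x : Plane) (r : ℝ) :
    closure (place x r A) ⊆ place x r (closure A) := by
  refine closure_minimal (image_mono subset_closure) ?_
  exact (hA.isCompact_closure.image (by fun_prop)).isClosed

/-- Enlarging each hole to a round disk removes the shapes `K n` from the rest of the argument. -/
theorem AdmissiblePerforation.sdiff_subset_sieve {δ₀ δ₁ ε : ℝ} (hK : AdmissibleShapes K)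
    (hP : AdmissiblePerforation R δ₀ δ₁ ε r K N ξ) :
    crossSection R \ ⋃ n ∈ Finset.Icc 1 N, disk (ξ n) (δ₀ * r) ⊆ sieve R r K N ξ :=
  sdiff_subset_sdiff_right <| iUnion₂_mono fun n hn =>
    (closure_place_subset (hK.isBounded n) _ _).trans (hP.hole_subset n hn)

theorem AdmissiblePerforation.pairwiseDisjoint {δ₀ δ₁ ε : ℝ} (hρ : 0 < δ₁ * ε)
    (hP : AdmissiblePerforation R δ₀ δ₁ ε r K N ξ) :
    (Finset.Icc 1 N : Set ℕ).PairwiseDisjoint fun n => disk (ξ n) (δ₁ * ε) := by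
  intro n hn m hm hnm
  refine Metric.ball_disjoint_ball ?_
  rw [← two_mul]
  exact two_mul_le_dist_of_frontier_disjoint hρ
    (hP.disjoint n (Finset.mem_coe.1 hn) m (Finset.mem_coe.1 hm) hnm)

theorem AdmissiblePerforation.radius_le {δ₀ δ₁ ε : ℝ} (hρ : 0 < δ₀ * r)
    (hP : AdmissiblePerforation R δ₀ δ₁ ε r K N ξ) : δ₀ * r ≤ δ₁ * ε := by
  have hN : 1 ∈ Finset.Icc 1 N := Finset.mem_Icc.2 ⟨le_rfl, hP.one_le⟩
  by_contra! hlt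
  have h := hP.disk_subset 1 hN
  -- A point at distance `s` from the center lies in the inner disk but not in the outer one. The
  -- maximum with `0` covers a negative `δ₁ * ε`.
  set s := max 0 (δ₁ * ε) with hs
  have hmem : ξ 1 + EuclideanSpace.single 0 s ∈ disk (ξ 1) (δ₀ * r) := by
    have : |s| < δ₀ * r := by rw [abs_of_nonneg (le_max_left _ _)]; exact max_lt hρ hlt
    simpa [disk] using this
  have h2 : |s| < δ₁ * ε := by simpa [disk] using h hmem
  exact absurd ((le_max_right _ _).trans (le_abs_self _)) h2.not_ge

theorem AdmissiblePerforation.radius_lt {δ₀ δ₁ ε : ℝ} (hρ : 0 < δ₁ * ε)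
    (hP : AdmissiblePerforation R δ₀ δ₁ ε r K N ξ) : δ₁ * ε < R :=
  have hN : 1 ∈ Finset.Icc 1 N := Finset.mem_Icc.2 ⟨le_rfl, hP.one_le⟩
  radius_lt_of_frontier_disjoint hρ (hP.subset_section 1 hN) (hP.away_from_boundary 1 hN)

theorem notMem_closure_plane {p : Space3} (hp : p.2 ≠ 0) (A : Set Plane) :
    p ∉ closure ((fun x : Plane => ((x, 0) : Space3)) '' A) := by
  intro h
  have hcl : IsClosed {q : Space3 | q.2 = 0} := isClosed_eq continuous_snd continuous_const
  refine hp (closure_minimal (t := {q : Space3 | q.2 = 0}) ?_ hcl h)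
  rintro _ ⟨x, -, rfl⟩
  rfl

theorem upperCylinder_subset_fluidDomain :
    upperCylinder R h ⊆ fluidDomain R h r K N ξ :=
  fun _ hp => ⟨hp.1, notMem_closure_plane hp.2.1.ne' _⟩

theorem lowerCylinder_subset_fluidDomain :
    lowerCylinder R h ⊆ fluidDomain R h r K N ξ :=
  fun _ hp => ⟨hp.1, notMem_closure_plane hp.2.2.ne _⟩

theorem prod_subset_upperCylinder (hR : R < h) (ρ : ℝ) (_ : 0 < ρ) (hρR : ρ ≤ R) :
    crossSection R ×ˢ Ioo 0 ρ ⊆ upperCylinder R h := by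
  rintro p ⟨hp1, hp2, hp3⟩
  exact ⟨⟨hp1, by linarith, by linarith⟩, hp2, by linarith⟩

theorem prod_subset_lowerCylinder (hR : R < h) (ρ : ℝ) (_ : 0 < ρ) (hρR : ρ ≤ R) :
    crossSection R ×ˢ Ioo (-ρ) 0 ⊆ lowerCylinder R h := by
  rintro p ⟨hp1, hp2, hp3⟩
  exact ⟨⟨hp1, by linarith, by linarith⟩, by linarith, hp3⟩

end Perforations

/-! ### Combination of the two regimes -/

/-- The trace estimate on one side of the sieve, with a constant that depends only on `R`, `ε_*`,
`δ₀` and `δ₁`. -/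
theorem exists_one_sided_trace_estimate {R εs δ₀ δ₁ : ℝ} (hR : 0 < R) (hεs : 0 < εs)
    (hδ₀ : 0 < δ₀) (hδ₁ : 0 < δ₁) :
    ∃ C : ℝ, 0 < C ∧ ∀ (K : ℕ → Set Plane) (α : ℝ) (N : ℝ → ℕ) (ξ : ℝ → ℕ → Plane),
      AdmissibleShapes K →
      (∀ ε ∈ Ioc 0 εs,
        AdmissiblePerforation R δ₀ δ₁ ε (holeScale α ε) K (N ε) (ξ ε)) →
      ∀ ε ∈ Ioc 0 εs, ∀ (F : Type) [NormedAddCommGroup F] [InnerProductSpace ℝ F]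
        [CompleteSpace F] (T : ℝ → Set ℝ) (U : Set Space3) (φ : Space3 → F)
        (G : Space3 → GradVal F) (g : Plane → F), IsOneSided T →
        (∀ ρ, 0 < ρ → ρ ≤ R → crossSection R ×ˢ T ρ ⊆ U) →
        AEStronglyMeasurable G (volume.restrict U) → IsTrace R U φ G g →
        (∀ᵐ x ∂(volume.restrict (sieve R (holeScale α ε) K (N ε) (ξ ε))), g x = 0) →
        eLpNorm g 2 (volume.restrict (crossSection R)) ≤
          ENNReal.ofReal (C * √(holeScale α ε)) * eLpNorm G 2 (volume.restrict U) := by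
  -- The constant is chosen before the perforations. If `δ₁ * εs ≥ R`, no admissible family exists
  -- at the level `εs`, and any constant works.
  by_cases hlt : δ₁ * εs < R
  swap
  · refine ⟨1, one_pos, fun K α N ξ _ hP => absurd ?_ hlt⟩
    exact (hP εs ⟨hεs, le_rfl⟩).radius_lt (by positivity)
  obtain ⟨ε₀, hε₀, hscale⟩ := exists_lower_bound_scale hδ₀ hδ₁ hεs
  obtain ⟨θ, hθ, hfrac⟩ := exists_uncovered_fraction hR (mul_pos hδ₁ hε₀) hlt
  -- `c` bounds `r` from below in the large-hole regime, since there `r > δ₁ ε / (2 δ₀)` and `ε ≥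
  -- ε₀`. Thus `432 * R / θ` is at most `432 * R / θ / c * r`, and `B` adds the constants of both
  -- regimes.
  set c := δ₁ * ε₀ / (2 * δ₀) with hc
  have hc0 : 0 < c := by positivity
  set B := 1728 * δ₀ + 432 * R / θ / c with hB
  have hB0 : 0 < B := by positivity
  refine ⟨√B, Real.sqrt_pos.2 hB0, ?_⟩
  intro K α N ξ hK hP ε hε F _ _ _ T U φ G g hT hTU hGU htr hg
  have hr : ∀ ε, 0 < holeScale α ε := fun ε => Real.exp_pos _
  set r := holeScale α ε
  have hr0 : 0 < r := hr ε
  have hρ : 0 < δ₁ * ε := mul_pos hδ₁ hε.1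
  have hPε := hP ε hε
  have hgoal : ∫⁻ x in crossSection R, ‖g x‖ₑ ^ 2 ≤
      ENNReal.ofReal (B * r) * ∫⁻ p in U, ‖G p‖ₑ ^ 2 := by
    have hg' := ae_restrict_of_ae_restrict_of_subset (hPε.sdiff_subset_sieve hK) hg
    rcases le_or_gt (2 * (δ₀ * r)) (δ₁ * ε) with hsmall | hlarge
    · refine (trace_estimate_of_small_holes hT hTU hGU htr (mul_pos hδ₀ hr0) hsmall
        (hPε.radius_lt hρ).le hPε.subset_section (hPε.pairwiseDisjoint hρ) hg').trans ?_
      gcongr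
      rw [show (1728 : ℝ≥0∞) = ENNReal.ofReal 1728 by simp, ← ENNReal.ofReal_mul (by norm_num)]
      refine ENNReal.ofReal_le_ofReal ?_
      rw [← mul_assoc]
      have : 0 ≤ 432 * R / θ / c := by positivity
      gcongr
      linarith
    · have hεlow : ε₀ ≤ ε := hscale α
        (fun ε' hε' => (hP ε' hε').radius_le (mul_pos hδ₀ (hr ε'))) ε hε hlarge
      have hθA := hfrac (δ₁ * ε) (N ε) (ξ ε) (by gcongr) (by gcongr; exact hε.2)
        hPε.subset_section (hPε.pairwiseDisjoint hρ)
      have hsub : crossSection R \ ⋃ n ∈ Finset.Icc 1 (N ε), disk (ξ ε n) (δ₁ * ε) ⊆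
          crossSection R \ ⋃ n ∈ Finset.Icc 1 (N ε), disk (ξ ε n) (δ₀ * r) :=
        sdiff_subset_sdiff_right (iUnion₂_mono hPε.disk_subset)
      refine (trace_estimate_of_fraction hT hR hTU hGU htr sdiff_subset hθ hθA
        (ae_restrict_of_ae_restrict_of_subset hsub hg')).trans ?_
      gcongr
      have hcr : c ≤ r := by
        rw [hc, div_le_iff₀ (by positivity)]
        have : δ₁ * ε₀ ≤ δ₁ * ε := by gcongr
        linarith
      calc 432 * R / θ = 432 * R / θ / c * c := by field_simp
        _ ≤ 432 * R / θ / c * r := by gcongr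
        _ ≤ B * r := by
          have : 0 ≤ 1728 * δ₀ := by positivity
          gcongr
          linarith
  rw [← ENNReal.pow_le_pow_left_iff two_ne_zero, mul_pow, eLpNorm_two_sq,
    eLpNorm_two_sq, ← ENNReal.ofReal_pow (by positivity), mul_pow, Real.sq_sqrt hB0.le,
    Real.sq_sqrt hr0.le]
  exact hgoal

/-- Both one-sided estimates use cylinders of height at most `R < h`, so `C` does not involve `h`.
Each half cylinder lies in the fluid domain because the closure of the sieve stays in the plane `z =
0`. -/
theorem lemma2p2 (R h εs δ₀ δ₁ : ℝ) (hR : 0 < R) (hh : R < h) (hεs : 0 < εs) (hεs1 : εs < 1)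
    (hδ₀ : 0 < δ₀) (hδ₁ : 0 < δ₁) :
    ∃ C : ℝ, 0 < C ∧
      ∀ (K : ℕ → Set Plane) (α : ℝ) (N : ℝ → ℕ) (ξ : ℝ → ℕ → Plane),
        AdmissibleShapes K →
        (∀ n, ENNReal.ofReal εs * volume (K n) < ENNReal.ofReal (Real.pi * R ^ 2)) →
        0 < α →
        (∀ ε ∈ Set.Ioc 0 εs,
          AdmissiblePerforation R δ₀ δ₁ ε (holeScale α ε) K (N ε) (ξ ε)) →
        ∀ ε ∈ Set.Ioc 0 εs,
        ∀ (F : Type) [NormedAddCommGroup F] [InnerProductSpace ℝ F] [FiniteDimensional ℝ F]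
          (φ : Space3 → F) (G : Space3 → GradVal F) (gPlus gMinus : Plane → F),
          IsH1 (fluidDomain R h (holeScale α ε) K (N ε) (ξ ε)) φ G →
          IsTrace R (upperCylinder R h) φ G gPlus →
          IsTrace R (lowerCylinder R h) φ G gMinus →
          (∀ᵐ x ∂(volume.restrict (sieve R (holeScale α ε) K (N ε) (ξ ε))),
            gPlus x = 0 ∧ gMinus x = 0) →
          eLpNorm gPlus 2 (volume.restrict (crossSection R)) ≤
              ENNReal.ofReal (C * √(holeScale α ε)) *
                eLpNorm G 2
                  (volume.restrict (fluidDomain R h (holeScale α ε) K (N ε) (ξ ε))) ∧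
            eLpNorm gMinus 2 (volume.restrict (crossSection R)) ≤
              ENNReal.ofReal (C * √(holeScale α ε)) *
                eLpNorm G 2
                  (volume.restrict (fluidDomain R h (holeScale α ε) K (N ε) (ξ ε))) := by
  obtain ⟨C, hC, hest⟩ := exists_one_sided_trace_estimate hR hεs hδ₀ hδ₁
  refine ⟨C, hC, ?_⟩
  intro K α N ξ hK _ _ hP ε hε F _ _ _ φ G gPlus gMinus hφ hplus hminus hzero
  have : CompleteSpace F := FiniteDimensional.complete ℝ F
  have hmono {U : Set Space3} (hU : U ⊆ fluidDomain R h (holeScale α ε) K (N ε) (ξ ε)) :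
      volume.restrict U ≤ volume.restrict (fluidDomain R h (holeScale α ε) K (N ε) (ξ ε)) :=
    Measure.restrict_mono hU le_rfl
  have hup := hmono upperCylinder_subset_fluidDomain
  have hlow := hmono lowerCylinder_subset_fluidDomain
  have hGm := hφ.memLp_grad.aestronglyMeasurable
  constructor
  · refine (hest K α N ξ hK hP ε hε F _ _ φ G gPlus isOneSided_upper
      (prod_subset_upperCylinder hh) (hGm.mono_measure hup) hplus
      (hzero.mono fun x hx => hx.1)).trans ?_
    gcongr
  · refine (hest K α N ξ hK hP ε hε F _ _ φ G gMinus isOneSided_lower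
      (prod_subset_lowerCylinder hh) (hGm.mono_measure hlow) hminus
      (hzero.mono fun x hx => hx.2)).trans ?_
    gcongr
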